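/- A continuum is a nonempty compact connected metrizable space. A covering map $f:Y\to X$ is called a regular covering map with deck group $G$ if it is the quotient map $Y\to X=Y/G$ of a free action by a group $G$ of homeomorphisms of $Y$. Let $X$ be a continuum. Consider all regular covering maps $f:Y\to X=Y/G$ with $Y$ a continuum, where two covers are identified if there are a homeomorphism $h$ of the covering spaces over $X$ and an isomorphism $\theta$ of the deck groups such that $h\circ g=\theta(g)\circ h$ for all $g$. Let $f_i:X_i\to X=X_i/G_i$ be representatives of the resulting classes, one for each class. Write $i\le j$ if there is a continuous onto map $f_{ij}:X_j\to X_i$ with $f_j=f_i\circ f_{ij}$. **Theorem (Existence).** For every continuum $X$: 1. The set of all covers $f_i:X_i\to X=X_i/G_i$, ordered by $\le$, is a (nonempty, partially ordered) directed set. 2. There are continuous onto maps $f_{ij}:X_j\to X_i$ $(i\le j)$ with $f_j=f_i\circ f_{ij}$ and homomorphisms $\theta_{ij}:G_j\to G_i$ with $\theta_{ij}(g)\circ f_{ij}=f_{ij}\circ g$ for all $g\in G_j$, such that $f_{ii}=\mathrm{id}$, $\theta_{ii}=\mathrm{id}$, $f_{ik}=f_{ij}\circ f_{jk}$ and $\theta_{ik}=\theta_{ij}\circ\theta_{jk}$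 whenever $i\le j\le k$. For every such choice, each $f_{ij}$ is a regular covering map, and it is unique modulo $G_i$: the regular covering maps $f:X_j\to X_i$ with $f_j=f_i\circ f$ are exactly the maps $g\circ f_{ij}$ with $g\in G_i$. 3. For every such choice, the inverse limit $\widehat X=\varprojlim X_i$ is a continuum. Each $G_i$ is finite, so $\pi_P(X)=\varprojlim G_i$ (with the inverse limit topology, the $G_i$ being discrete) is a profinite group. It acts on $\widehat X$ coordinatewise, and the inverse limit topology of $\pi_P(X)$ is the topology of uniform convergence on $\widehat X$. The projection $\widehat\phi:\widehat X\to X=\widehat X/\pi_P(X)$, $\widehat\phi((x_i)_i)=f_i(x_i)$ for any $i$, is a generalized regular covering map with deck group $\pi_P(X)$. Here a generalized regular covering map $\phi:Y\to X$ of uniform spaces with deck group $G$ is the quotient map by a group $G$ of bijections of $Y$ (that is, $\phi$ is onto and uniformly continuous, it takes entourages to entourages, and its point preimages are the orbits of $G$) such that: the uniformity of $Y$ has a basis of $G$-invariant entourages; for every entourage $E$ of $Y$ there is an entourage $F$ such that every element $h$ of the subgroup generated by $\{g\in G:(y,g(y))\in F\text{ for some }y\in Y\}$ satisfies $(y,h(y))\in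 E$ for all $y\in Y$; and $G$ is complete in the uniformity of uniform convergence. Compact Hausdorff spaces carry their unique compatible uniformity. -/

import Mathlib

open Set Filter Topology Uniformity UniformConvergence

universe u v w

/-- A continuum: a (nonempty) compact, connected, metrizable topological space. -/
class IsContinuum (X : Type u) [TopologicalSpace X] : Prop where
  compact : CompactSpace X
  connected : ConnectedSpace X
  metrizable : TopologicalSpace.MetrizableSpace X

attribute [instance] IsContinuum.compact IsContinuum.connected IsContinuum.metrizable

/-! ### Traditional regular covering maps -/

/-- `f : Y → X = Y / G` is a regular covering map with group `G`: it is a covering map in the usual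
sense, and it is the quotient map of the free action of the group `G` of homeomorphisms of `Y`. -/
structure IsRegularCoveringMapWith {Y : Type u} {X : Type v} [TopologicalSpace Y]
    [TopologicalSpace X] (G : Subgroup (Y ≃ₜ Y)) (f : Y → X) : Prop where
  isCoveringMap : IsCoveringMap f
  isQuotientMap : IsQuotientMap f
  fiber_iff : ∀ y z : Y, f y = f z ↔ ∃ g ∈ G, g y = z
  free : ∀ g ∈ G, ∀ y : Y, g y = y → g = 1

/-- `f` is a regular covering map (with respect to some group of homeomorphisms). -/
def IsRegularCoveringMap {Y : Type u} {X : Type v} [TopologicalSpace Y] [TopologicalSpace X]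
    (f : Y → X) : Prop :=
  ∃ G : Subgroup (Y ≃ₜ Y), IsRegularCoveringMapWith G f

/-- A regular cover `f : Y → X = Y / G` of `X` by a continuum `Y`. -/
structure ContinuumCover (X : Type u) [TopologicalSpace X] : Type (u + 1) where
  space : Type u
  [top : TopologicalSpace space]
  [isContinuum : IsContinuum space]
  map : space → X
  deck : Subgroup (space ≃ₜ space)
  isRegular : IsRegularCoveringMapWith deck map

namespace ContinuumCover

attribute [instance] ContinuumCover.top ContinuumCover.isContinuum

variable {X : Type u} [TopologicalSpace X]

/-- Two covers of `X` are equivalent if there are a homeomorphism `h` over `X` and a compatible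
isomorphism `θ` of the deck groups. -/
def Equivalent (C D : ContinuumCover X) : Prop :=
  ∃ (h : C.space ≃ₜ D.space) (θ : C.deck ≃* D.deck),
    (∀ y, D.map (h y) = C.map y) ∧
    ∀ (g : C.deck) (y : C.space), h (g.1 y) = (θ g).1 (h y)

theorem equivalent_equivalence : Equivalence (Equivalent (X := X)) where
  refl _ := ⟨Homeomorph.refl _, MulEquiv.refl _, fun _ => rfl, fun _ _ => rfl⟩
  symm := by
    rintro C D ⟨h, θ, h1, h2⟩
    refine ⟨h.symm, θ.symm, fun y => ?_, fun g y => ?_⟩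
    · rw [← h1, h.apply_symm_apply]
    · apply h.injective
      rw [h2, h.apply_symm_apply, h.apply_symm_apply, θ.apply_symm_apply]
  trans := by
    rintro C D E ⟨h, θ, h1, h2⟩ ⟨k, η, k1, k2⟩
    refine ⟨h.trans k, θ.trans η, fun y => ?_, fun g y => ?_⟩
    · simp only [Homeomorph.trans_apply, k1, h1]
    · simp only [Homeomorph.trans_apply, h2, k2, MulEquiv.trans_apply]

instance setoid (X : Type u) [TopologicalSpace X] : Setoid (ContinuumCover X) :=
  ⟨Equivalent, equivalent_equivalence⟩

/-- `C ≤ D` if there is a continuous onto map `D.space → C.space` over `X`. -/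
instance preorder : Preorder (ContinuumCover X) where
  le C D := ∃ f : D.space → C.space, Continuous f ∧ Function.Surjective f ∧ D.map = C.map ∘ f
  le_refl _ := ⟨id, continuous_id, Function.surjective_id, rfl⟩
  le_trans := by
    rintro C D E ⟨f, hf, hf', hfm⟩ ⟨g, hg, hg', hgm⟩
    exact ⟨f ∘ g, hf.comp hg, hf'.comp hg', by rw [hgm, hfm]; rfl⟩

end ContinuumCover

/-- The index set of all covers of `X` by continua: distinct indices are non-equivalent covers. -/
def CoverIndex (X : Type u) [TopologicalSpace X] : Type (u + 1) :=
  Quotient (ContinuumCover.setoid X)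

namespace CoverIndex

variable {X : Type u} [TopologicalSpace X]

/-- The cover `f_i : X_i → X = X_i / G_i` with index `i`. -/
noncomputable def cover (i : CoverIndex X) : ContinuumCover X := Quotient.out i

/-- The continuum `X_i`. -/
abbrev Space (i : CoverIndex X) : Type u := i.cover.space

/-- The covering map `f_i : X_i → X`. -/
noncomputable abbrev map (i : CoverIndex X) : i.Space → X := i.cover.map

/-- The deck group `G_i`. -/
abbrev Deck (i : CoverIndex X) : Type u := i.cover.deck

noncomputable instance preorder : Preorder (CoverIndex X) := Preorder.lift cover

end CoverIndex

/-! ### The inverse system and its limit -/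

/-- An inverse system formed by the covers `X_i` and their deck groups `G_i`: the bonding maps
`f_ij : X_j → X_i` are continuous onto maps over `X`, and the homomorphisms `θ_ij : G_j → G_i` are
compatible with them. -/
structure BondingSystem (X : Type u) [TopologicalSpace X] where
  map : ∀ i j : CoverIndex X, i ≤ j → j.Space → i.Space
  continuous : ∀ i j h, Continuous (map i j h)
  surjective : ∀ i j h, Function.Surjective (map i j h)
  map_over : ∀ i j h, i.map ∘ map i j h = j.map
  map_self : ∀ i h, map i i h = id
  map_comp : ∀ i j k hij hjk hik, map i j hij ∘ map j k hjk = map i k hik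
  hom : ∀ i j : CoverIndex X, i ≤ j → j.Deck →* i.Deck
  hom_self : ∀ i h, hom i i h = MonoidHom.id _
  hom_comp : ∀ i j k hij hjk hik, (hom i j hij).comp (hom j k hjk) = hom i k hik
  compat : ∀ i j h (g : j.Deck) (y : j.Space), (hom i j h g).1 (map i j h y) = map i j h (g.1 y)

namespace BondingSystem

variable {X : Type u} [TopologicalSpace X] (S : BondingSystem X)

/-- The inverse limit `X̂` of the spaces `X_i`. -/
def Limit : Type (u + 1) :=
  {x : ∀ i : CoverIndex X, i.Space // ∀ i j h, S.map i j h (x j) = x i}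

/-- `X̂` has the inverse limit topology. -/
instance limitTopology : TopologicalSpace S.Limit :=
  inferInstanceAs (TopologicalSpace
    {x : ∀ i : CoverIndex X, i.Space // ∀ i j h, S.map i j h (x j) = x i})

/-- The inverse limit `π_P(X)` of the groups `G_i`. -/
def deckLimit : Subgroup (∀ i : CoverIndex X, i.Deck) where
  carrier := {g | ∀ i j h, S.hom i j h (g j) = g i}
  one_mem' := fun i j h => map_one (S.hom i j h)
  mul_mem' := fun {a b} ha hb i j h => by
    rw [Pi.mul_apply, map_mul, ha i j h, hb i j h, Pi.mul_apply]
  inv_mem' := fun {a} ha i j h => by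
    rw [Pi.inv_apply, map_inv, ha i j h, Pi.inv_apply]

/-- `π_P(X)` has the inverse limit topology, where every `G_i` is discrete. -/
instance deckLimitTopology : TopologicalSpace S.deckLimit :=
  ⨅ i : CoverIndex X, TopologicalSpace.induced (fun g : S.deckLimit => g.1 i) ⊥

/-- `π_P(X)` acts on `X̂` coordinatewise. -/
noncomputable instance deckLimitAction : MulAction S.deckLimit S.Limit where
  smul g x := ⟨fun i => (g.1 i).1 (x.1 i), fun i j h => by
    rw [← S.compat i j h, g.2 i j h, x.2 i j h]⟩
  one_smul _ := rfl
  mul_smul _ _ _ := rfl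

end BondingSystem

/-! ### Generalized regular covering maps of uniform spaces -/

section Uniform

variable (G : Type w) [Group G] {Y : Type u} [MulAction G Y]

/-- `U_E(G)`: the elements that move every point by at most `E`. -/
def uniformlyClose (E : Set (Y × Y)) : Set G := {g | ∀ y : Y, (y, g • y) ∈ E}

/-- `S_E(G)`: the elements that move some point by at most `E`. -/
def somewhereClose (E : Set (Y × Y)) : Set G := {g | ∃ y : Y, (y, g • y) ∈ E}

/-- `N_E(G)`: the subgroup generated by `S_E(G)`. -/
def closeSubgroup (E : Set (Y × Y)) : Subgroup G := Subgroup.closure (somewhereClose G E)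

/-- `G` acts isomorphically: the uniformity has a basis of `G`-invariant entourages. -/
def ActsIsomorphically (Y : Type u) [MulAction G Y] [UniformSpace Y] : Prop :=
  ∀ E ∈ 𝓤 Y, ∃ F ∈ 𝓤 Y, F ⊆ E ∧
    ∀ g : G, (fun p : Y × Y => (g • p.1, g • p.2)) '' F = F

/-- `G` acts prodiscretely: for every entourage `E` there is an entourage `F` such that
`N_F(G) ⊆ U_E(G)`. -/
def ActsProdiscretely (Y : Type u) [MulAction G Y] [UniformSpace Y] : Prop :=
  ∀ E ∈ 𝓤 Y, ∃ F ∈ 𝓤 Y, (closeSubgroup G F : Set G) ⊆ uniformlyClose G E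

/-- The uniformity of uniform convergence on a group of bijections of a uniform space. -/
@[reducible] def uniformConvergenceUniformity (Y : Type u) [MulAction G Y] [UniformSpace Y] :
    UniformSpace G :=
  UniformSpace.comap (fun g : G => UniformFun.ofFun (fun y : Y => g • y)) inferInstance

/-- A bi-uniformly continuous map: a surjective, uniformly continuous map that takes entourages to
entourages. -/
structure IsBiUniformlyContinuous {Y : Type u} {X : Type v} [UniformSpace Y] [UniformSpace X]
    (f : Y → X) : Prop where
  surjective : Function.Surjective f
  uniformContinuous : UniformContinuous f
  image_mem : ∀ E ∈ 𝓤 Y, Prod.map f f '' E ∈ 𝓤 X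

/-- `f : Y → X = Y / G` is a generalized regular covering map with deck group `G`: `G` is a group
of bijections of `Y` that is complete in the uniformity of uniform convergence and acts
isomorphically and prodiscretely, and `f` is the quotient map. -/
structure IsGeneralizedRegularCoveringMap {X : Type v} [UniformSpace Y] [UniformSpace X]
    (f : Y → X) : Prop where
  faithful : FaithfulSMul G Y
  isomorphic : ActsIsomorphically G Y
  prodiscrete : ActsProdiscretely G Y
  complete : @CompleteSpace G (uniformConvergenceUniformity G Y)
  biUniform : IsBiUniformlyContinuous f
  fiber_iff : ∀ y z : Y, f y = f z ↔ ∃ g : G, g • y = z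

/-- A generalized regular covering map between compact Hausdorff spaces, each with its unique
compatible uniformity. -/
def IsCompactGeneralizedRegularCoveringMap [TopologicalSpace Y] [CompactSpace Y] [T2Space Y]
    {X : Type v} [TopologicalSpace X] [CompactSpace X] [T2Space X] (f : Y → X) : Prop :=
  letI : UniformSpace Y := uniformSpaceOfCompactR1
  letI : UniformSpace X := uniformSpaceOfCompactR1
  IsGeneralizedRegularCoveringMap G f

/-- The topology of uniform convergence on a group acting on a compact Hausdorff space with its
unique compatible uniformity. -/
@[reducible] def uniformConvergenceTopology (Y : Type u) [MulAction G Y] [TopologicalSpace Y] [CompactSpace Y]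
    [T2Space Y] : TopologicalSpace G :=
  letI : UniformSpace Y := uniformSpaceOfCompactR1
  (uniformConvergenceUniformity G Y).toTopologicalSpace

end Uniform

/-- A profinite group: a compact, Hausdorff, totally disconnected topological group. -/
structure IsProfiniteGroup (G : Type w) [Group G] [TopologicalSpace G] : Prop where
  topologicalGroup : IsTopologicalGroup G
  compact : CompactSpace G
  hausdorff : T2Space G
  totallyDisconnected : TotallyDisconnectedSpace G

/-! ### Local homeomorphisms and regular covering maps -/

/-! The first half rests on the rigidity of lifts. Two maps from a connected space into a regular
cover with the same composite to `X` differ by one deck transformation (`exists_deck_comp_eq`), and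
coincide if they agree at one point. This makes mutually dominating covers equivalent, makes bonding
maps unique modulo `G_i`, and produces the homomorphisms `θ_ij`; basepoints over a single point of
`X` make all choices compatible. Upper bounds are connected clopen pieces of fiber products.

Fibers are compact and discrete, so the deck groups are finite. A cover is determined up to
equivalence by a finite nerve whose sheets project to members of a countable basis
(`IsSheetNerve.exists_map`), so there are only countably many classes and the limit is metrizable.

In the limit, compactness and directedness reduce every entourage to a single index
(`exists_kernelPair_subset`). At that index a finite group acts freely, so some neighborhood of the
diagonal contains no pair `(y, g y)` with `g ≠ 1`. These two facts give prodiscreteness and the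
equality of the two topologies; the first alone gives connectedness. Completeness follows from
compactness of the limit group. -/

theorem isLocalHomeomorph_of_isOpenMap_of_injOn {Y : Type*} {Z : Type*} [TopologicalSpace Y]
    [TopologicalSpace Z] {f : Y → Z} (hc : Continuous f) (ho : IsOpenMap f)
    (hi : ∀ y, ∃ U ∈ 𝓝 y, InjOn f U) : IsLocalHomeomorph f := by
  rw [isLocalHomeomorph_iff_isOpenEmbedding_restrict]
  intro y
  obtain ⟨U, hU, hinj⟩ := hi y
  refine ⟨interior U, interior_mem_nhds.2 hU, ?_⟩
  refine .of_continuous_injective_isOpenMap (hc.comp continuous_subtype_val) ?_ ?_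
  · exact (hinj.mono interior_subset).injective
  · exact ho.comp isOpen_interior.isOpenMap_subtype_val

/-- The projection of a fiber product along a local homeomorphism is a local homeomorphism. -/
theorem IsLocalHomeomorph.fiberProduct_fst {Y Z X : Type*} [TopologicalSpace Y]
    [TopologicalSpace Z] [TopologicalSpace X] {f : Y → X} {g : Z → X} (hf : Continuous f)
    (hg : IsLocalHomeomorph g) :
    IsLocalHomeomorph (fun p : {p : Y × Z // f p.1 = g p.2} => p.1.1) := by
  apply isLocalHomeomorph_of_isOpenMap_of_injOn (by fun_prop)
  · rw [isOpenMap_iff_nhds_le]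
    rintro ⟨⟨y, z⟩, hyz⟩ S hS
    rw [mem_map, nhds_subtype_eq_comap, mem_comap] at hS
    obtain ⟨T, hT, hTS⟩ := hS
    obtain ⟨A, hA, B, hB, hAB⟩ := mem_nhds_prod_iff.1 hT
    have hB' : f ⁻¹' (g '' B) ∈ 𝓝 y := by
      apply hf.continuousAt
      change f y = g z at hyz
      rw [hyz]
      exact hg.isOpenMap.image_mem_nhds hB
    refine mem_of_superset (inter_mem hA hB') ?_
    rintro y' ⟨hyA, z', hz', hyz'⟩
    exact hTS (show (⟨(y', z'), hyz'.symm⟩ : {p : Y × Z // f p.1 = g p.2}).1 ∈ T from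
      hAB ⟨hyA, hz'⟩)
  · rintro ⟨⟨y, z⟩, hyz⟩
    obtain ⟨e, hz, rfl⟩ := hg z
    refine ⟨(fun p => p.1.2) ⁻¹' e.source,
      (e.open_source.preimage (by fun_prop)).mem_nhds hz, ?_⟩
    rintro ⟨⟨a, b⟩, hab⟩ hb ⟨⟨c, d⟩, hcd⟩ hd (rfl : a = c)
    have : b = d := e.injOn hb hd (hab.symm.trans hcd)
    subst this
    rfl

/-- The group of all homeomorphisms over the base. -/
def fullDeckGroup {Y : Type u} {Z : Type v} [TopologicalSpace Y] (f : Y → Z) :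
    Subgroup (Y ≃ₜ Y) where
  carrier := {h | ∀ y, f (h y) = f y}
  one_mem' _ := rfl
  mul_mem' {a b} ha hb y := (ha (b y)).trans (hb y)
  inv_mem' {a} ha y := by
    have := ha (a⁻¹ y)
    rw [← this]
    exact congrArg f (a.apply_symm_apply y)

/-- Freeness is automatic: a homeomorphism over the base with a fixed point agrees with the identity
by uniqueness of lifts. Only transitivity on fibers has to be checked. -/
theorem isRegularCoveringMapWith_fullDeckGroup {Y : Type u} {Z : Type v} [TopologicalSpace Y]
    [TopologicalSpace Z] [CompactSpace Y] [T2Space Y] [ConnectedSpace Y] [T2Space Z] {f : Y → Z}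
    (hf : IsLocalHomeomorph f) (hs : Function.Surjective f)
    (ht : ∀ y z, f y = f z → ∃ h : Y ≃ₜ Y, (∀ x, f (h x) = f x) ∧ h y = z) :
    IsRegularCoveringMapWith (fullDeckGroup f) f where
  isCoveringMap := isLocalHomeomorph_iff_isCoveringMap.1 hf
  isQuotientMap := (isLocalHomeomorph_iff_isCoveringMap.1 hf).isQuotientMap hs
  fiber_iff y z := ⟨fun h => ht y z h, fun ⟨g, hg, h⟩ => by rw [← h]; exact (hg y).symm⟩
  free g hg y hy := by
    have := (isLocalHomeomorph_iff_isCoveringMap.1 hf).eq_of_comp_eq g.continuous continuous_id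
      (funext hg) y hy
    exact Homeomorph.ext fun x => congrFun this x

/-- A continuous map from a nonempty compact space to a connected space is onto if it is a local
homeomorphism. -/
theorem IsLocalHomeomorph.surjective_of_compact {Y Z : Type*} [TopologicalSpace Y]
    [TopologicalSpace Z] [CompactSpace Y] [Nonempty Y] [T2Space Z] [PreconnectedSpace Z]
    {f : Y → Z} (hf : IsLocalHomeomorph f) : Function.Surjective f := by
  have h : IsClopen (range f) :=
    ⟨(isCompact_range hf.continuous).isClosed, hf.isOpenMap.isOpen_range⟩
  exact range_eq_univ.1 (h.eq_univ (range_nonempty f))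

/-- A compact space with a local homeomorphism to a connected Hausdorff space contains a nonempty
connected clopen set. -/
theorem IsLocalHomeomorph.exists_isClopen_isConnected {Y Z : Type*} [TopologicalSpace Y]
    [TopologicalSpace Z] [CompactSpace Y] [T2Space Y] [Nonempty Y] [T2Space Z] [ConnectedSpace Z]
    {f : Y → Z} (hf : IsLocalHomeomorph f) : ∃ K : Set Y, IsClopen K ∧ IsConnected K := by
  obtain ⟨z⟩ : Nonempty Z := inferInstance
  have hfin : (f ⁻¹' {z}).Finite := by
    have : IsCompact (f ⁻¹' {z}) := (isClosed_singleton.preimage hf.continuous).isCompact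
    have hd := (isLocalHomeomorph_iff_isCoveringMap.1 hf z).discreteTopology_fiber
    exact this.finite ⟨hd⟩
  have key : ∀ K : Set Y, IsClopen K → K.Nonempty → (K ∩ f ⁻¹' {z}).Nonempty := by
    intro K hK hne
    have h : IsClopen (f '' K) :=
      ⟨(hK.1.isCompact.image hf.continuous).isClosed, hf.isOpenMap _ hK.2⟩
    have := h.eq_univ (hne.image f)
    obtain ⟨y, hy, hyz⟩ := this.symm.subset (mem_univ z)
    exact ⟨y, hy, hyz⟩
  -- Since every nonempty clopen set meets the fiber, one that meets it in the fewest points has no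
  -- proper nonempty clopen subset.
  obtain ⟨K, ⟨hK, hne⟩, hmin⟩ := exists_minimalFor_of_wellFoundedLT
    (fun K : Set Y => IsClopen K ∧ K.Nonempty) (fun K => (K ∩ f ⁻¹' {z}).ncard)
    ⟨univ, isClopen_univ, univ_nonempty⟩
  have hsub : ∀ L : Set Y, IsClopen L → L.Nonempty → L ⊆ K → L = K := by
    intro L hL hLne hLK
    by_contra hneq
    have hD : (K \ L).Nonempty := by
      rw [nonempty_iff_ne_empty, Ne, sdiff_eq_empty]
      exact fun h => hneq (hLK.antisymm h)
    obtain ⟨y, ⟨hyK, hyL⟩, hy⟩ := key _ (hK.diff hL) hD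
    have hlt : (L ∩ f ⁻¹' {z}).ncard < (K ∩ f ⁻¹' {z}).ncard := by
      apply ncard_lt_ncard _ (hfin.subset inter_subset_right)
      exact ⟨inter_subset_inter_left _ hLK, fun h => hyL (h ⟨hyK, hy⟩).1⟩
    exact absurd (hmin ⟨hL, hLne⟩ hlt.le) (not_le.2 hlt)
  refine ⟨K, hK, hne, ?_⟩
  rw [isPreconnected_iff_subset_of_fully_disjoint_closed hK.1]
  intro A B hA hB hKAB hAB
  by_contra! hcon
  obtain ⟨h1, h2⟩ := hcon
  have e1 : K ∩ A = K \ B := by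
    ext y
    have := fun h : y ∈ K => hKAB h
    have := fun h : y ∈ A => disjoint_left.1 hAB h
    simp only [mem_union, mem_inter_iff, Set.mem_sdiff] at *
    tauto
  have hc : IsClopen (K ∩ A) := ⟨hK.1.inter hA, by rw [e1]; exact hK.2.sdiff hB⟩
  rcases (K ∩ A).eq_empty_or_nonempty with he | he
  · apply h2
    intro y hy
    rcases hKAB hy with h | h
    · exact absurd (show y ∈ K ∩ A from ⟨hy, h⟩) (by rw [he]; exact notMem_empty y)
    · exact h
  · exact h1 (by rw [← hsub _ hc he inter_subset_left]; exact inter_subset_right)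

/-! ### Covers of a continuum -/

namespace ContinuumCover

variable {X : Type u} [TopologicalSpace X] (C : ContinuumCover X)

theorem isLocalHomeomorph_map : IsLocalHomeomorph C.map :=
  C.isRegular.isCoveringMap.isLocalHomeomorph

theorem surjective_map : Function.Surjective C.map := C.isRegular.isQuotientMap.surjective

theorem map_deck (g : C.deck) (y : C.space) : C.map (g.1 y) = C.map y :=
  ((C.isRegular.fiber_iff y _).2 ⟨g.1, g.2, rfl⟩).symm

variable {C} in
theorem deck_eq_of_apply_eq {g h : C.deck} {y : C.space} (e : g.1 y = h.1 y) : g = h := by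
  have := C.isRegular.free (h⁻¹ * g).1 (h⁻¹ * g).2 y (by
    change h.1.symm (g.1 y) = y
    rw [e, h.1.symm_apply_apply])
  exact (inv_mul_eq_one.1 (Subtype.ext this)).symm

variable {C} in
/-- Two lifts of the same map to `C.space` differ by a deck transformation. -/
theorem exists_deck_comp_eq {A : Type*} [TopologicalSpace A] [ConnectedSpace A] {f g : A → C.space}
    (hf : Continuous f) (hg : Continuous g) (h : ∀ a, C.map (f a) = C.map (g a)) :
    ∃ d : C.deck, ∀ a, d.1 (f a) = g a := by
  obtain ⟨a⟩ : Nonempty A := inferInstance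
  obtain ⟨d, hd, e⟩ := (C.isRegular.fiber_iff _ _).1 (h a)
  refine ⟨⟨d, hd⟩, congrFun (C.isRegular.isCoveringMap.eq_of_comp_eq (d.continuous.comp hf) hg
    (funext fun b => ?_) a e)⟩
  exact (C.map_deck ⟨d, hd⟩ (f b)).trans (h b)

variable {C} in
theorem eq_of_comp_eq {A : Type*} [TopologicalSpace A] [ConnectedSpace A] {f g : A → C.space}
    (hf : Continuous f) (hg : Continuous g) (h : ∀ a, C.map (f a) = C.map (g a)) (a : A)
    (ha : f a = g a) : f = g :=
  C.isRegular.isCoveringMap.eq_of_comp_eq hf hg (funext h) a ha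

/-- By freeness the group embeds as an orbit in a fiber, which is compact and discrete. -/
instance finite_deck [T1Space X] : Finite C.deck := by
  obtain ⟨y⟩ : Nonempty C.space := inferInstance
  have hfin : (C.map ⁻¹' {C.map y}).Finite := by
    have : IsCompact (C.map ⁻¹' {C.map y}) :=
      (isClosed_singleton.preimage C.isLocalHomeomorph_map.continuous).isCompact
    exact this.finite ⟨(C.isRegular.isCoveringMap _).discreteTopology_fiber⟩
  have := hfin.to_subtype
  exact Finite.of_injective
    (fun g : C.deck => (⟨g.1 y, C.map_deck g y⟩ : C.map ⁻¹' {C.map y}))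
    fun g h e => deck_eq_of_apply_eq (congrArg Subtype.val e)

/-- The pairs of distinct points with the same image form a closed set. -/
theorem isClosed_kernelPair_diff_diagonal [T1Space X] :
    IsClosed {p : C.space × C.space | C.map p.1 = C.map p.2 ∧ p.1 ≠ p.2} := by
  -- The set is the union of the graphs of the finitely many nontrivial deck transformations.
  have : {p : C.space × C.space | C.map p.1 = C.map p.2 ∧ p.1 ≠ p.2} =
      ⋃ g : {g : C.deck // g ≠ 1}, {p | g.1.1 p.1 = p.2} := by
    ext ⟨y, z⟩
    simp only [mem_ofPred_eq, mem_iUnion]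
    constructor
    · rintro ⟨h, hne⟩
      obtain ⟨g, hg, e⟩ := (C.isRegular.fiber_iff _ _).1 h
      refine ⟨⟨⟨g, hg⟩, ?_⟩, e⟩
      intro h1
      have h1 : g = 1 := congrArg Subtype.val h1
      subst h1
      exact hne e
    · rintro ⟨⟨g, hg⟩, e⟩
      refine ⟨by rw [← e, C.map_deck], ?_⟩
      rintro rfl
      exact hg (deck_eq_of_apply_eq (h := 1) e)
  rw [this]
  exact isClosed_iUnion_of_finite fun g =>
    isClosed_eq (g.1.1.continuous.comp continuous_fst) continuous_snd

variable {C} {D : ContinuumCover X}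

theorem Equivalent.le (h : Equivalent C D) : D ≤ C := by
  obtain ⟨h, -, h1, -⟩ := h
  exact ⟨h, h.continuous, h.surjective, (funext h1).symm⟩

/-- The composite `g ∘ f` is a self-map of `D.space` over `X`, hence a deck transformation. So `f`
is injective, and a homeomorphism by compactness; conjugation by it carries one deck group onto the
other. -/
theorem equivalent_of_le_of_le (h : C ≤ D) (h' : D ≤ C) : Equivalent C D := by
  obtain ⟨f, hf, hfs, hfm⟩ := h
  obtain ⟨g, hg, -, hgm⟩ := h'
  have hfm := congrFun hfm
  have hgm := congrFun hgm
  obtain ⟨d, hd⟩ := exists_deck_comp_eq continuous_id (hg.comp hf)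
    (fun a => (hfm a).trans (hgm (f a)))
  have hinj : Function.Injective f := by
    intro y z e
    apply d.1.injective
    exact (hd y).trans ((congrArg g e).trans (hd z).symm)
  let e : D.space ≃ₜ C.space :=
    (isHomeomorph_iff_continuous_bijective.2 ⟨hf, hinj, hfs⟩).homeomorph f
  have he : ∀ y, C.map (e y) = D.map y := fun y => (hfm y).symm
  apply equivalent_equivalence.symm
  have hex : ∀ d : D.deck, ∃ c : C.deck, ∀ y, c.1 (e y) = e (d.1 y) := fun d =>
    exists_deck_comp_eq e.continuous (e.continuous.comp d.1.continuous)
      (fun a => (he a).trans ((D.map_deck d a).symm.trans (he _).symm))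
  choose θ hθ using hex
  obtain ⟨y⟩ : Nonempty D.space := inferInstance
  let θ' : D.deck →* C.deck := MonoidHom.mk' θ fun a b => deck_eq_of_apply_eq (y := e y) (by
    rw [hθ]
    change e (a.1 (b.1 y)) = (θ a).1 ((θ b).1 (e y))
    rw [hθ, hθ])
  refine ⟨e, MulEquiv.ofBijective θ' ⟨?_, ?_⟩, he, fun g y => (hθ g y).symm⟩
  · intro a b hab
    apply deck_eq_of_apply_eq (y := y)
    apply e.injective
    rw [← hθ, ← hθ]
    exact congrArg (fun c : C.deck => c.1 (e y)) hab
  · intro c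
    have h1 : D.map y = D.map (e.symm (c.1 (e y))) := by
      rw [← he, ← he, e.apply_symm_apply, C.map_deck]
    obtain ⟨d, hd, h2⟩ := (D.isRegular.fiber_iff _ _).1 h1
    refine ⟨⟨d, hd⟩, deck_eq_of_apply_eq (y := e y) ?_⟩
    refine (hθ ⟨d, hd⟩ y).trans ?_
    change e (d y) = _
    rw [h2, e.apply_symm_apply]

variable (X) in
/-- The trivial cover. -/
def trivialCover [IsContinuum X] : ContinuumCover X where
  space := X
  map := id
  deck := ⊥
  isRegular :=
    { isCoveringMap := isLocalHomeomorph_iff_isCoveringMap.1 (Homeomorph.refl X).isLocalHomeomorph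
      isQuotientMap := .id
      fiber_iff := fun y z => by simp
      free := fun g hg _ _ => hg }

/-- Two covers have a common upper bound: a connected component of the fiber product. -/
theorem exists_upper_bound [IsContinuum X] (C D : ContinuumCover X) :
    ∃ E : ContinuumCover X, C ≤ E ∧ D ≤ E := by
  let P := {p : C.space × D.space // C.map p.1 = D.map p.2}
  have hcl : IsClosed {p : C.space × D.space | C.map p.1 = D.map p.2} :=
    isClosed_eq (C.isLocalHomeomorph_map.continuous.comp continuous_fst)
      (D.isLocalHomeomorph_map.continuous.comp continuous_snd)
  have : CompactSpace P := isCompact_iff_compactSpace.1 hcl.isCompact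
  have : Nonempty P := by
    obtain ⟨y⟩ : Nonempty C.space := inferInstance
    obtain ⟨z, hz⟩ := D.surjective_map (C.map y)
    exact ⟨⟨(y, z), hz.symm⟩⟩
  have h1 : IsLocalHomeomorph (fun p : P => p.1.1) :=
    IsLocalHomeomorph.fiberProduct_fst C.isLocalHomeomorph_map.continuous D.isLocalHomeomorph_map
  have h0 : IsLocalHomeomorph (fun p : P => C.map p.1.1) := C.isLocalHomeomorph_map.comp h1
  have h2 : IsLocalHomeomorph (fun p : P => p.1.2) :=
    IsLocalHomeomorph.of_comp (g := D.map)
      (by convert h0 using 1; exact funext fun p => p.2.symm) D.isLocalHomeomorph_map (by fun_prop)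
  obtain ⟨K, hK, hKc⟩ := h0.exists_isClopen_isConnected
  have hKcompact : CompactSpace K := isCompact_iff_compactSpace.1 hK.1.isCompact
  have hKconn : ConnectedSpace K := isConnected_iff_connectedSpace.1 hKc
  have hv : IsLocalHomeomorph (Subtype.val : K → P) :=
    hK.2.isOpenEmbedding_subtypeVal.isLocalHomeomorph
  have : TopologicalSpace.MetrizableSpace P :=
    IsEmbedding.subtypeVal.metrizableSpace
  have : IsContinuum K := ⟨hKcompact, hKconn, inferInstance⟩
  -- `K` and its image are both connected and clopen, so they coincide as soon as they meet.
  have hstable : ∀ h : P ≃ₜ P, (h '' K ∩ K).Nonempty → ∀ p, h p ∈ K ↔ p ∈ K := by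
    intro h ⟨p, hp, hpK⟩
    have e : h '' K = K := by
      apply Subset.antisymm
      · exact (hKc.image h h.continuous.continuousOn).isPreconnected.subset_isClopen hK ⟨p, hp, hpK⟩
      · exact hKc.isPreconnected.subset_isClopen ⟨h.isClosedMap _ hK.1, h.isOpenMap _ hK.2⟩
          ⟨p, hpK, hp⟩
    intro p
    conv_lhs => rw [← e]
    exact h.injective.mem_set_image
  refine ⟨{ space := K, map := fun k => C.map k.1.1.1, deck := fullDeckGroup _,
            isRegular := isRegularCoveringMapWith_fullDeckGroup (h0.comp hv)
              (h0.comp hv).surjective_of_compact ?_ }, ?_, ?_⟩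
  · rintro ⟨⟨⟨a, b⟩, hab⟩, hp⟩ ⟨⟨⟨c, d⟩, hcd⟩, hq⟩ h
    obtain ⟨g, hg, e1⟩ := (C.isRegular.fiber_iff a c).1 h
    obtain ⟨g', hg', e2⟩ := (D.isRegular.fiber_iff b d).1 (hab.symm.trans (h.trans hcd))
    -- Transitivity on the fibers of `K`: a product of deck transformations joins the two points in
    -- `P`, and it preserves `K` because both points lie there.
    let φ : P ≃ₜ P := (g.prodCongr g').subtype fun p => by
      change _ ↔ C.map (g p.1) = D.map (g' p.2)
      rw [C.map_deck ⟨g, hg⟩, D.map_deck ⟨g', hg'⟩]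
    have hφ : φ ⟨(a, b), hab⟩ = ⟨(c, d), hcd⟩ := Subtype.ext (Prod.ext e1 e2)
    have hs := hstable φ ⟨_, ⟨_, hp, hφ⟩, hq⟩
    refine ⟨φ.subtype fun p => (hs p).symm, fun x => ?_, Subtype.ext hφ⟩
    exact C.map_deck ⟨g, hg⟩ _
  · exact ⟨fun k => k.1.1.1, (h1.comp hv).continuous, (h1.comp hv).surjective_of_compact, rfl⟩
  · exact ⟨fun k => k.1.1.2, (h2.comp hv).continuous, (h2.comp hv).surjective_of_compact,
      funext fun k => k.1.2⟩

end ContinuumCover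

/-! ### There are only countably many covers -/

/-- The nerve of a finite cover by sheets: `V` lists the images of the sheets, and `R` tells which
sheets meet. -/
def IsSheetNerve {Y X : Type*} [TopologicalSpace Y] (f : Y → X) {m : ℕ} (V : Fin m → Set X)
    (R : Set (Fin m × Fin m)) : Prop :=
  ∃ U : Fin m → Set Y, (∀ a, IsOpen (U a)) ∧ (∀ y, ∃ a, y ∈ U a) ∧ (∀ a, f '' U a = V a) ∧
    (∀ a b, (a, b) ∈ R ↔ (U a ∩ U b).Nonempty) ∧
    ∀ a b, (U a ∩ U b).Nonempty → InjOn f (U a ∪ U b)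

/-- Open maps with the same sheet nerve have the same total space. -/
theorem IsSheetNerve.exists_map {Y Z X : Type*} [TopologicalSpace Y] [TopologicalSpace Z]
    [TopologicalSpace X] {f : Y → X} {g : Z → X} {m : ℕ} {V : Fin m → Set X}
    {R : Set (Fin m × Fin m)} (hf : Continuous f) (hg : IsOpenMap g) (hfV : IsSheetNerve f V R)
    (hgV : IsSheetNerve g V R) :
    ∃ h : Y → Z, Continuous h ∧ Function.Surjective h ∧ f = g ∘ h := by
  obtain ⟨U, hUo, hUc, hUV, hUR, -⟩ := hfV
  obtain ⟨W, hWo, hWc, hWV, hWR, hWi⟩ := hgV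
  have hex : ∀ y, ∃ z, g z = f y ∧ ∃ a, y ∈ U a ∧ z ∈ W a := by
    intro y
    obtain ⟨a, ha⟩ := hUc y
    have : f y ∈ g '' W a := by
      rw [hWV, ← hUV]
      exact mem_image_of_mem f ha
    obtain ⟨z, hz, e⟩ := this
    exact ⟨z, e, a, ha, hz⟩
  choose h hh a hUa hWa using hex
  -- The value `h y` does not depend on the sheet chosen: if `U a` and `U b` meet, so do `W a` and
  -- `W b`, and `g` is injective on their union.
  have key : ∀ y b, y ∈ U b → h y ∈ W b := by
    intro y b hy
    have hne : (W (a y) ∩ W b).Nonempty := (hWR _ _).1 ((hUR _ _).2 ⟨y, hUa y, hy⟩)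
    have : f y ∈ g '' W b := by
      rw [hWV, ← hUV]
      exact mem_image_of_mem f hy
    obtain ⟨z, hz, e⟩ := this
    have : h y = z := hWi _ _ hne (Or.inl (hWa y)) (Or.inr hz) ((hh y).trans e.symm)
    rwa [this]
  have hinj : ∀ b, InjOn g (W b) := by
    intro b z hz z' hz'
    exact hWi b b ⟨z, hz, hz⟩ (Or.inl hz) (Or.inl hz')
  refine ⟨h, ?_, ?_, funext fun y => (hh y).symm⟩
  · rw [continuous_iff_continuousAt]
    intro y S hS
    have hn : f ⁻¹' (g '' (S ∩ W (a y))) ∈ 𝓝 y := by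
      apply hf.continuousAt
      rw [← hh y]
      exact hg.image_mem_nhds (inter_mem hS ((hWo _).mem_nhds (hWa y)))
    refine mem_map.2 (mem_of_superset (inter_mem hn ((hUo _).mem_nhds (hUa y))) ?_)
    rintro x ⟨hx, hxU⟩
    obtain ⟨w, ⟨hwS, hwW⟩, e⟩ := hx
    have : h x = w := hinj _ (key x _ hxU) hwW ((hh x).trans e.symm)
    rwa [mem_preimage, this]
  · intro z
    obtain ⟨b, hb⟩ := hWc z
    have : g z ∈ f '' U b := by
      rw [hUV, ← hWV]
      exact mem_image_of_mem g hb
    obtain ⟨y, hy, e⟩ := this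
    exact ⟨y, hinj b (key y b hy) hb ((hh y).trans e)⟩

namespace ContinuumCover

variable {X : Type u} [TopologicalSpace X]

/-- Every cover has a sheet nerve formed by members of a given basis. -/
theorem exists_isSheetNerve [T1Space X] (C : ContinuumCover X) {B : Set (Set X)}
    (hB : TopologicalSpace.IsTopologicalBasis B) :
    ∃ (m : ℕ) (V : Fin m → B) (R : Set (Fin m × Fin m)),
      IsSheetNerve C.map (fun a => (V a : Set X)) R := by
  let : UniformSpace C.space := uniformSpaceOfCompactR1
  -- With `E ○ E` inside this entourage, two `E`-small sheets that meet have a union on which the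
  -- covering map is injective.
  have hN : {p : C.space × C.space | C.map p.1 = C.map p.2 ∧ p.1 ≠ p.2}ᶜ ∈ 𝓤 C.space := by
    rw [← nhdsSet_diagonal_eq_uniformity]
    refine C.isClosed_kernelPair_diff_diagonal.isOpen_compl.mem_nhdsSet.2 ?_
    rintro ⟨y, z⟩ (h : y = z) h'
    exact h'.2 h
  obtain ⟨E, hE, hEN⟩ := comp_mem_uniformity_sets hN
  have hinj : ∀ {x y z}, (x, y) ∈ E → (y, z) ∈ E → C.map x = C.map z → x = z := by
    intro x y z h1 h2 h
    by_contra hne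
    exact hEN (SetRel.prodMk_mem_comp h1 h2) ⟨h, hne⟩
  have hloc : ∀ y, ∃ U : Set C.space, IsOpen U ∧ y ∈ U ∧ C.map '' U ∈ B ∧
      ∀ a ∈ U, ∀ b ∈ U, (a, b) ∈ E := by
    intro y
    have : E ∈ 𝓝 y ×ˢ 𝓝 y := by
      rw [← nhds_prod_eq]
      exact nhds_le_uniformity y hE
    obtain ⟨O, hO, hOE⟩ := mem_prod_same_iff.1 this
    have := C.isLocalHomeomorph_map.isOpenMap.image_mem_nhds (interior_mem_nhds.2 hO)
    obtain ⟨b, hb, hyb, hbO⟩ := hB.mem_nhds_iff.1 this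
    -- Cutting down by the preimage of `b ⊆ C.map '' interior O` makes the image of the sheet
    -- exactly the basis member `b`.
    refine ⟨interior O ∩ C.map ⁻¹' b, isOpen_interior.inter
      ((hB.isOpen hb).preimage C.isLocalHomeomorph_map.continuous),
      ⟨mem_interior_iff_mem_nhds.2 hO, hyb⟩, ?_, fun p hp q hq =>
        hOE ⟨interior_subset hp.1, interior_subset hq.1⟩⟩
    rwa [image_inter_preimage, inter_eq_right.2 hbO]
  choose U hUo hUy hUB hUE using hloc
  obtain ⟨t, ht⟩ := CompactSpace.elim_nhds_subcover U fun y => (hUo y).mem_nhds (hUy y)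
  let e := t.equivFin.symm
  refine ⟨t.card, fun a => ⟨C.map '' U (e a), hUB _⟩,
    {p | (U (e p.1) ∩ U (e p.2)).Nonempty}, fun a => U (e a), fun a => hUo _, fun y => ?_,
    fun a => rfl, fun a b => Iff.rfl, ?_⟩
  · have : y ∈ ⋃ x ∈ t, U x := by rw [ht]; trivial
    obtain ⟨x, hx, hy⟩ := mem_iUnion₂.1 this
    refine ⟨e.symm ⟨x, hx⟩, ?_⟩
    change y ∈ U (e (e.symm ⟨x, hx⟩))
    rwa [e.apply_symm_apply]
  · rintro a b ⟨w, hwa, hwb⟩ x (hx | hx) z (hz | hz) h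
    · exact hinj (hUE _ _ hx _ hx) (hUE _ _ hx _ hz) h
    · exact hinj (hUE _ _ hx _ hwa) (hUE _ _ hwb _ hz) h
    · exact hinj (hUE _ _ hx _ hwb) (hUE _ _ hwa _ hz) h
    · exact hinj (hUE _ _ hx _ hx) (hUE _ _ hx _ hz) h

end ContinuumCover

/-! ### The index set -/

namespace CoverIndex

variable {X : Type u} [TopologicalSpace X]

instance [IsContinuum X] : Nonempty (CoverIndex X) :=
  ⟨Quotient.mk _ (ContinuumCover.trivialCover X)⟩

theorem le_antisymm' {i j : CoverIndex X} (h : i ≤ j) (h' : j ≤ i) : i = j :=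
  Quotient.out_equiv_out.1 (ContinuumCover.equivalent_of_le_of_le h h')

theorem equivalent_cover_mk (C : ContinuumCover X) :
    ContinuumCover.Equivalent (cover (Quotient.mk _ C)) C :=
  Quotient.mk_out C

theorem exists_upper_bound [IsContinuum X] (i j : CoverIndex X) : ∃ k, i ≤ k ∧ j ≤ k := by
  obtain ⟨E, hi, hj⟩ := ContinuumCover.exists_upper_bound i.cover j.cover
  have h : E ≤ cover (Quotient.mk _ E) := (equivalent_cover_mk E).le
  exact ⟨Quotient.mk _ E, hi.trans h, hj.trans h⟩

instance [IsContinuum X] : IsDirectedOrder (CoverIndex X) := ⟨exists_upper_bound⟩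

/-- There are countably many nerves over a countable basis, and covers with the same nerve dominate
each other. -/
instance [IsContinuum X] : Countable (CoverIndex X) := by
  let B := TopologicalSpace.countableBasis X
  have hB := TopologicalSpace.isBasis_countableBasis X
  have : Countable B := TopologicalSpace.countable_countableBasis X
  have h := fun i : CoverIndex X => i.cover.exists_isSheetNerve hB
  choose m V R hV using h
  let F : CoverIndex X → Σ m : ℕ, (Fin m → B) × Set (Fin m × Fin m) := fun i => ⟨m i, V i, R i⟩
  have hF : ∀ i, IsSheetNerve i.map (fun a => ((F i).2.1 a : Set X)) (F i).2.2 := hV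
  have hle : ∀ i j, F i = F j → i ≤ j := by
    intro i j e
    have hi := hF i
    rw [e] at hi
    exact IsSheetNerve.exists_map j.cover.isLocalHomeomorph_map.continuous
      i.cover.isLocalHomeomorph_map.isOpenMap (hF j) hi
  have hinj : Function.Injective F := fun i j e => le_antisymm' (hle i j e) (hle j i e.symm)
  exact hinj.countable

end CoverIndex

/-! ### Bonding maps -/

-- Each bonding map is corrected by a deck transformation so that it preserves basepoints over a
-- fixed `x`. Uniqueness of lifts then forces the composition laws, and freeness forces those of the
-- homomorphisms.
open ContinuumCover in
theorem nonempty_bondingSystem (X : Type u) [TopologicalSpace X] [IsContinuum X] :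
    Nonempty (BondingSystem X) := by
  obtain ⟨x⟩ : Nonempty X := inferInstance
  choose b hb using fun i : CoverIndex X => i.cover.surjective_map x
  have hex : ∀ i j : CoverIndex X, i ≤ j → ∃ f : j.Space → i.Space, Continuous f ∧
      Function.Surjective f ∧ (∀ y, i.map (f y) = j.map y) ∧ f (b j) = b i := by
    rintro i j ⟨f, hf, hfs, hfm⟩
    have hfm := congrFun hfm
    obtain ⟨g, hg, e⟩ := (i.cover.isRegular.fiber_iff (f (b j)) (b i)).1
      ((hfm _).symm.trans ((hb j).trans (hb i).symm))
    exact ⟨g ∘ f, g.continuous.comp hf, g.surjective.comp hfs,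
      fun y => (i.cover.map_deck ⟨g, hg⟩ _).trans (hfm y).symm, e⟩
  choose f hfc hfs hfm hfb using hex
  have hθ : ∀ i j (h : i ≤ j) (g : j.Deck), ∃ d : i.Deck, ∀ y, d.1 (f i j h y) = f i j h (g.1 y) :=
    fun i j h g => exists_deck_comp_eq (hfc i j h) ((hfc i j h).comp g.1.continuous) fun y =>
      ((hfm i j h y).trans ((j.cover.map_deck g y).symm.trans (hfm i j h _).symm))
  choose θ hθ using hθ
  have hcomp : ∀ i j k hij hjk hik, f i j hij ∘ f j k hjk = f i k hik := by
    intro i j k hij hjk hik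
    refine eq_of_comp_eq ((hfc i j hij).comp (hfc j k hjk)) (hfc i k hik) (fun y => ?_) (b k) ?_
    · exact (hfm i j hij _).trans ((hfm j k hjk y).trans (hfm i k hik y).symm)
    · rw [Function.comp_apply, hfb, hfb, hfb]
  have hid : ∀ i h, f i i h = id := fun i h =>
    eq_of_comp_eq (hfc i i h) continuous_id (hfm i i h) (b i) (hfb i i h)
  exact ⟨{
    map := f
    continuous := hfc
    surjective := hfs
    map_over := fun i j h => funext (hfm i j h)
    map_self := hid
    map_comp := hcomp
    hom := fun i j h => MonoidHom.mk' (θ i j h) fun a c => deck_eq_of_apply_eq (y := f i j h (b j))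
      (by
        rw [hθ]
        change f i j h (a.1 (c.1 (b j))) = (θ i j h a).1 ((θ i j h c).1 (f i j h (b j)))
        rw [hθ, hθ])
    hom_self := fun i h => MonoidHom.ext fun g => deck_eq_of_apply_eq (y := f i i h (b i)) (by
      refine (hθ i i h g (b i)).trans ?_
      rw [hid]
      rfl)
    hom_comp := fun i j k hij hjk hik => MonoidHom.ext fun g =>
      deck_eq_of_apply_eq (y := f i k hik (b k)) (by
        refine Eq.trans ?_ (hθ i k hik g (b k)).symm
        rw [← hcomp i j k hij hjk hik]
        change (θ i j hij (θ j k hjk g)).1 (f i j hij (f j k hjk (b k))) =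
          f i j hij (f j k hjk (g.1 (b k)))
        rw [hθ, hθ])
    compat := fun i j h g y => hθ i j h g y }⟩

namespace BondingSystem

open ContinuumCover

variable {X : Type u} [TopologicalSpace X] (S : BondingSystem X)

theorem map_map (i j : CoverIndex X) (h : i ≤ j) (y : j.Space) : i.map (S.map i j h y) = j.map y :=
  congrFun (S.map_over i j h) y

/-- Two points with the same image in `X_i` are joined by some `d` in `G_j`. Its image in `G_i`
fixes a point, hence is trivial, so `d` is a homeomorphism over `X_i`. -/
theorem isRegularCoveringMap_deck_comp [T2Space X] (i j : CoverIndex X) (h : i ≤ j) (g : i.Deck) :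
    IsRegularCoveringMap (g.1 ∘ S.map i j h) := by
  have hl : IsLocalHomeomorph (S.map i j h) := IsLocalHomeomorph.of_comp (g := i.map)
    (by rw [S.map_over]; exact j.cover.isLocalHomeomorph_map) i.cover.isLocalHomeomorph_map
    (S.continuous i j h)
  refine ⟨_, isRegularCoveringMapWith_fullDeckGroup (g.1.isLocalHomeomorph.comp hl)
    (g.1.surjective.comp (S.surjective i j h)) fun y z e => ?_⟩
  have e : S.map i j h y = S.map i j h z := g.1.injective e
  obtain ⟨d, hd, hdy⟩ := (j.cover.isRegular.fiber_iff y z).1 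
    ((S.map_map i j h y).symm.trans ((congrArg i.map e).trans (S.map_map i j h z)))
  have h1 : S.hom i j h ⟨d, hd⟩ = 1 := deck_eq_of_apply_eq (y := S.map i j h y) (by
    rw [S.compat]
    change S.map i j h (d y) = S.map i j h y
    rw [hdy, e])
  refine ⟨d, fun x => congrArg g.1 ?_, hdy⟩
  have := S.compat i j h ⟨d, hd⟩ x
  rw [h1] at this
  exact this.symm

theorem isRegularCoveringMap_and_map_comp_eq_iff [T2Space X] (i j : CoverIndex X) (h : i ≤ j)
    (f : j.Space → i.Space) :
    IsRegularCoveringMap f ∧ i.map ∘ f = j.map ↔ ∃ g : i.Deck, f = g.1 ∘ S.map i j h := by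
  constructor
  · rintro ⟨⟨G, hG⟩, hf⟩
    obtain ⟨g, hg⟩ := exists_deck_comp_eq (S.continuous i j h) hG.isCoveringMap.continuous
      fun y => (S.map_map i j h y).trans (congrFun hf y).symm
    exact ⟨g, funext fun y => (hg y).symm⟩
  · rintro ⟨g, rfl⟩
    exact ⟨S.isRegularCoveringMap_deck_comp i j h g, funext fun y =>
      (i.cover.map_deck g _).trans (S.map_map i j h y)⟩

end BondingSystem

/-! ### The inverse limit -/

theorem isProfiniteGroup_of_isClosed {G : Type*} [Group G] [TopologicalSpace G]
    [IsTopologicalGroup G] [CompactSpace G] [T2Space G] [TotallyDisconnectedSpace G]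
    {H : Subgroup G} (h : IsClosed (H : Set G)) : IsProfiniteGroup H :=
  ⟨inferInstance, isCompact_iff_compactSpace.1 h.isCompact, inferInstance, inferInstance⟩

namespace BondingSystem

open ContinuumCover

variable {X : Type u} [TopologicalSpace X] (S : BondingSystem X)

variable {S} in
theorem Limit.ext {x y : S.Limit} (h : ∀ i, x.1 i = y.1 i) : x = y := Subtype.ext (funext h)

theorem t2Space_limit : T2Space S.Limit :=
  inferInstanceAs (T2Space {x : ∀ i : CoverIndex X, i.Space // ∀ i j h, S.map i j h (x j) = x i})

theorem continuous_proj (i : CoverIndex X) : Continuous fun x : S.Limit => x.1 i :=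
  (continuous_apply i).comp continuous_subtype_val

theorem compactSpace_limit : CompactSpace S.Limit := by
  have : IsClosed {x : ∀ i : CoverIndex X, i.Space | ∀ i j h, S.map i j h (x j) = x i} := by
    simp only [ofPred_forall]
    exact isClosed_iInter fun i => isClosed_iInter fun j => isClosed_iInter fun h =>
      isClosed_eq ((S.continuous i j h).comp (continuous_apply j)) (continuous_apply i)
  exact isCompact_iff_compactSpace.1 this.isCompact

attribute [local instance] t2Space_limit compactSpace_limit

/-- This is where countability of the index set enters: the limit lies in a countable product of
second-countable spaces. -/
theorem metrizableSpace_limit [IsContinuum X] : TopologicalSpace.MetrizableSpace S.Limit := by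
  have : SecondCountableTopology S.Limit :=
    (IsInducing.subtypeVal (Y := ∀ i : CoverIndex X, i.Space)).secondCountableTopology
  infer_instance

-- The points over `i.map y` form an inverse system of finite nonempty sets with surjective
-- transition maps, so every element extends to a thread.
open CategoryTheory in
theorem surjective_proj [IsContinuum X] (i : CoverIndex X) :
    Function.Surjective fun x : S.Limit => x.1 i := by
  intro y
  let F : (CoverIndex X)ᵒᵖ ⥤ Type u :=
    { obj := fun j => {z : j.unop.Space // j.unop.map z = i.map y}
      map := fun {j k} h => ↾fun z => ⟨S.map k.unop j.unop h.unop.le z.1,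
        (S.map_map _ _ _ _).trans z.2⟩
      map_id := fun j => by
        ext z
        exact congrFun (S.map_self _ _) z.1
      map_comp := fun {j k l} f g => by
        ext z
        exact congrFun (S.map_comp _ _ _ _ _ _).symm z.1 }
  have hfin : ∀ j, Finite (F.obj j) := fun j => by
    have h1 : IsCompact (j.unop.map ⁻¹' {i.map y}) :=
      (isClosed_singleton.preimage j.unop.cover.isLocalHomeomorph_map.continuous).isCompact
    exact (h1.finite ⟨(j.unop.cover.isRegular.isCoveringMap _).discreteTopology_fiber⟩).to_subtype
  have hne : ∀ j, Nonempty (F.obj j) := fun j => by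
    obtain ⟨z, hz⟩ := j.unop.cover.surjective_map (i.map y)
    exact ⟨⟨z, hz⟩⟩
  have hsurj : ∀ ⦃j k⦄ (f : j ⟶ k), Function.Surjective (F.map f) := by
    rintro j k f ⟨z, hz⟩
    obtain ⟨w, rfl⟩ := S.surjective _ _ f.unop.le z
    exact ⟨⟨w, (S.map_map _ _ _ _).symm.trans hz⟩, rfl⟩
  obtain ⟨s, hs⟩ := F.eval_section_surjective_of_surjective hsurj (Opposite.op i) ⟨y, rfl⟩
  refine ⟨⟨fun j => (s.1 (Opposite.op j)).1, fun j k h => ?_⟩, congrArg Subtype.val hs⟩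
  exact congrArg Subtype.val (s.2 (homOfLE h).op)

/-- Every neighborhood of the diagonal contains the kernel pair of some projection. -/
theorem exists_kernelPair_subset [IsContinuum X] {E : Set (S.Limit × S.Limit)}
    (hE : E ∈ 𝓝ˢ (diagonal S.Limit)) :
    ∃ i : CoverIndex X, ∀ x y : S.Limit, x.1 i = y.1 i → (x, y) ∈ E := by
  obtain ⟨U, hU, hdU, hUE⟩ := mem_nhdsSet_iff_exists.1 hE
  -- Off the diagonal some coordinate differs, so these open sets cover the compact set `Uᶜ`; they
  -- increase with `i`, so one of them suffices.
  obtain ⟨i, hi⟩ := hU.isClosed_compl.isCompact.elim_directed_cover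
    (fun i : CoverIndex X => {p : S.Limit × S.Limit | p.1.1 i ≠ p.2.1 i})
    (fun i => (isClosed_eq ((S.continuous_proj i).comp continuous_fst)
      ((S.continuous_proj i).comp continuous_snd)).isOpen_compl)
    (by
      rintro ⟨x, y⟩ h
      by_contra hcon
      have : ∀ i, x.1 i = y.1 i := by simpa using hcon
      exact h (hdU (Limit.ext this)))
    (by
      intro i j
      obtain ⟨k, hi, hj⟩ := CoverIndex.exists_upper_bound i j
      refine ⟨k, fun p hp e => hp ?_, fun p hp e => hp ?_⟩
      · rw [← p.1.2 i k hi, ← p.2.2 i k hi, e]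
      · rw [← p.1.2 j k hj, ← p.2.2 j k hj, e])
  refine ⟨i, fun x y h => hUE ?_⟩
  by_contra hcon
  exact hi hcon h

/-- Every neighborhood of the diagonal contains the preimage of a neighborhood of the diagonal of
some `X_i`. -/
theorem exists_preimage_subset [IsContinuum X] {E : Set (S.Limit × S.Limit)}
    (hE : E ∈ 𝓝ˢ (diagonal S.Limit)) :
    ∃ (i : CoverIndex X) (D : Set (i.Space × i.Space)), D ∈ 𝓝ˢ (diagonal i.Space) ∧
      ∀ x y : S.Limit, (x.1 i, y.1 i) ∈ D → (x, y) ∈ E := by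
  obtain ⟨U, hU, hdU, hUE⟩ := mem_nhdsSet_iff_exists.1 hE
  obtain ⟨i, hi⟩ := S.exists_kernelPair_subset (hU.mem_nhdsSet.2 hdU)
  let p : S.Limit × S.Limit → i.Space × i.Space := fun q => (q.1.1 i, q.2.1 i)
  have hp : Continuous p := ((S.continuous_proj i).comp continuous_fst).prodMk
    ((S.continuous_proj i).comp continuous_snd)
  -- The image of `Uᶜ` is compact, and by the choice of `i` it misses the diagonal.
  refine ⟨i, (p '' Uᶜ)ᶜ, ?_, fun x y h => hUE ?_⟩
  · refine (hU.isClosed_compl.isCompact.image hp).isClosed.isOpen_compl.mem_nhdsSet.2 ?_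
    rintro ⟨a, b⟩ (rfl : a = b) ⟨⟨x, y⟩, hxy, e⟩
    exact hxy (hi x y ((congrArg Prod.fst e).trans (congrArg Prod.snd e).symm))
  · by_contra hcon
    exact h ⟨(x, y), hcon, rfl⟩

theorem preimage_mem_nhdsSet_diagonal {i : CoverIndex X} {D : Set (i.Space × i.Space)}
    (hD : D ∈ 𝓝ˢ (diagonal i.Space)) :
    {p : S.Limit × S.Limit | (p.1.1 i, p.2.1 i) ∈ D} ∈ 𝓝ˢ (diagonal S.Limit) := by
  obtain ⟨U, hU, hdU, hUE⟩ := mem_nhdsSet_iff_exists.1 hD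
  have hp : Continuous fun q : S.Limit × S.Limit => (q.1.1 i, q.2.1 i) :=
    ((S.continuous_proj i).comp continuous_fst).prodMk ((S.continuous_proj i).comp continuous_snd)
  refine mem_nhdsSet_iff_exists.2 ⟨_, hU.preimage hp, ?_, fun q hq => hUE hq⟩
  rintro ⟨x, y⟩ (rfl : x = y)
  exact hdU rfl

/-- A clopen set is a union of fibers of some projection, so its image in the connected space `X_i`
is clopen. -/
theorem connectedSpace_limit [IsContinuum X] : ConnectedSpace S.Limit := by
  obtain ⟨i₀⟩ : Nonempty (CoverIndex X) := inferInstance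
  obtain ⟨y₀⟩ : Nonempty i₀.Space := inferInstance
  obtain ⟨x₀, -⟩ := S.surjective_proj i₀ y₀
  have : PreconnectedSpace S.Limit := by
    rw [preconnectedSpace_iff_clopen]
    intro U hU
    obtain ⟨i, hi⟩ := S.exists_kernelPair_subset (E := U ×ˢ U ∪ Uᶜ ×ˢ Uᶜ) (by
      refine ((hU.2.prod hU.2).union (hU.1.isOpen_compl.prod hU.1.isOpen_compl)).mem_nhdsSet.2 ?_
      rintro ⟨x, y⟩ (rfl : x = y)
      by_cases hx : x ∈ U
      · exact Or.inl ⟨hx, hx⟩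
      · exact Or.inr ⟨hx, hx⟩)
    let p := fun x : S.Limit => x.1 i
    have hcompl : p '' Uᶜ = (p '' U)ᶜ := by
      apply Subset.antisymm
      · rintro _ ⟨x, hx, rfl⟩ ⟨y, hy, e⟩
        rcases hi y x e with h | h
        · exact hx h.2
        · exact h.1 hy
      · intro a ha
        obtain ⟨x, rfl⟩ := S.surjective_proj i a
        exact ⟨x, fun hx => ha ⟨x, hx, rfl⟩, rfl⟩
    have hcl : IsClopen (p '' U) := by
      refine ⟨(hU.1.isCompact.image (S.continuous_proj i)).isClosed, ?_⟩
      rw [← isClosed_compl_iff, ← hcompl]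
      exact (hU.compl.1.isCompact.image (S.continuous_proj i)).isClosed
    rcases isClopen_iff.1 hcl with h | h
    · exact Or.inl (image_eq_empty.1 h)
    · right
      rw [h, compl_univ, image_eq_empty] at hcompl
      exact compl_empty_iff.1 hcompl
  exact { toNonempty := ⟨x₀⟩ }

theorem isContinuum_limit [IsContinuum X] : IsContinuum S.Limit :=
  ⟨inferInstance, S.connectedSpace_limit, S.metrizableSpace_limit⟩

attribute [local instance] isContinuum_limit

/-! ### The limit of the deck groups -/

theorem deckLimitTopology_eq_induced :
    S.deckLimitTopology = @instTopologicalSpaceSubtype (∀ i : CoverIndex X, i.Deck)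
      (fun g => g ∈ S.deckLimit) (@Pi.topologicalSpace _ _ fun _ => ⊥) := by
  unfold deckLimitTopology instTopologicalSpaceSubtype Pi.topologicalSpace
  rw [induced_iInf]
  exact iInf_congr fun i => (@induced_compose _ _ _ ⊥
    (Subtype.val : S.deckLimit → ∀ i : CoverIndex X, i.Deck) (fun g => g i)).symm

theorem isProfiniteGroup_deckLimit [T1Space X] : IsProfiniteGroup S.deckLimit := by
  let (i : CoverIndex X) : TopologicalSpace i.Deck := ⊥
  have (i : CoverIndex X) : DiscreteTopology i.Deck := ⟨rfl⟩
  have hcl : IsClosed (S.deckLimit : Set (∀ i : CoverIndex X, i.Deck)) := by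
    have : (S.deckLimit : Set (∀ i : CoverIndex X, i.Deck)) =
      {g | ∀ i j h, S.hom i j h (g j) = g i} := rfl
    rw [this]
    simp only [ofPred_forall]
    exact isClosed_iInter fun i => isClosed_iInter fun j => isClosed_iInter fun h =>
      isClosed_eq (continuous_of_discreteTopology.comp (continuous_apply j)) (continuous_apply i)
  rw [S.deckLimitTopology_eq_induced]
  exact isProfiniteGroup_of_isClosed hcl

/-- Agreement at a larger index implies agreement at smaller ones, so directedness replaces finitely
many coordinates by one. -/
theorem mem_nhds_deckLimit_iff [IsContinuum X] {g : S.deckLimit} {U : Set S.deckLimit} :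
    U ∈ 𝓝 g ↔ ∃ i, ∀ h : S.deckLimit, h.1 i = g.1 i → h ∈ U := by
  have h1 : 𝓝 g = ⨅ i, 𝓟 {h : S.deckLimit | h.1 i = g.1 i} := by
    unfold deckLimitTopology
    rw [nhds_iInf]
    refine iInf_congr fun i => ?_
    let : TopologicalSpace i.Deck := ⊥
    have : DiscreteTopology i.Deck := ⟨rfl⟩
    rw [nhds_induced, nhds_discrete, ← principal_singleton, comap_principal]
    rfl
  rw [h1, mem_iInf_of_directed]
  · rfl
  · intro i j
    obtain ⟨k, hi, hj⟩ := CoverIndex.exists_upper_bound i j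
    refine ⟨k, principal_mono.2 fun h (e : _ = _) => ?_, principal_mono.2 fun h (e : _ = _) => ?_⟩
    · change h.1 i = g.1 i
      rw [← h.2 i k hi, ← g.2 i k hi, e]
    · change h.1 j = g.1 j
      rw [← h.2 j k hj, ← g.2 j k hj, e]

/-- The diagonal of a cover has a neighborhood that contains no pair `(y, g y)` with `g ≠ 1`. -/
theorem _root_.ContinuumCover.exists_nhdsSet_diagonal_deck_eq_one [T1Space X]
    (C : ContinuumCover X) : ∃ D ∈ 𝓝ˢ (diagonal C.space),
      ∀ (g : C.deck) (y : C.space), (y, g.1 y) ∈ D → g = 1 := by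
  refine ⟨{p : C.space × C.space | C.map p.1 = C.map p.2 ∧ p.1 ≠ p.2}ᶜ,
    C.isClosed_kernelPair_diff_diagonal.isOpen_compl.mem_nhdsSet.2 ?_, fun g y h => ?_⟩
  · rintro ⟨y, z⟩ (h : y = z) h'
    exact h'.2 h
  · by_contra hg
    exact h ⟨(C.map_deck g y).symm, fun e => hg (deck_eq_of_apply_eq (h := 1) e.symm)⟩

/-- Closeness at a single point suffices: `h g⁻¹` moves the `i`-th coordinate of `g • y` so little
that freeness makes it trivial in `G_i`. -/
theorem exists_nhdsSet_diagonal_deckLimit_eq [T1Space X] (i : CoverIndex X) :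
    ∃ D ∈ 𝓝ˢ (diagonal S.Limit), ∀ (g h : S.deckLimit) (y : S.Limit),
      (g • y, h • y) ∈ D → h.1 i = g.1 i := by
  obtain ⟨D, hD, hDg⟩ := i.cover.exists_nhdsSet_diagonal_deck_eq_one
  refine ⟨_, S.preimage_mem_nhdsSet_diagonal hD, fun g h y hy => ?_⟩
  refine mul_inv_eq_one.1 (hDg (h.1 i * (g.1 i)⁻¹) ((g • y).1 i) ?_)
  have e : (h.1 i * (g.1 i)⁻¹).1 ((g • y).1 i) = (h • y).1 i := by
    change (h.1 i).1 ((g.1 i).1.symm ((g.1 i).1 (y.1 i))) = (h.1 i).1 (y.1 i)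
    rw [(g.1 i).1.symm_apply_apply]
  rw [e]
  exact hy

/-- Agreement at a suitable index gives uniform closeness by `exists_kernelPair_subset`; conversely,
closeness at one point gives agreement at a prescribed index. -/
theorem uniformConvergenceTopology_eq [IsContinuum X] :
    uniformConvergenceTopology S.deckLimit S.Limit = S.deckLimitTopology := by
  let : UniformSpace S.Limit := uniformSpaceOfCompactR1
  refine TopologicalSpace.ext_nhds fun g => ?_
  ext U
  rw [S.mem_nhds_deckLimit_iff]
  have hb := ((UniformFun.hasBasis_nhds S.Limit S.Limit
    (UniformFun.ofFun fun y : S.Limit => g • y)).comap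
      (fun g : S.deckLimit => UniformFun.ofFun fun y : S.Limit => g • y))
  rw [← nhds_induced] at hb
  refine hb.mem_iff.trans ⟨?_, ?_⟩
  · rintro ⟨E, hE, hEU⟩
    rw [← nhdsSet_diagonal_eq_uniformity] at hE
    obtain ⟨i, hi⟩ := S.exists_kernelPair_subset hE
    refine ⟨i, fun h e => hEU fun y => hi _ _ ?_⟩
    change (g.1 i).1 (y.1 i) = (h.1 i).1 (y.1 i)
    rw [e]
  · rintro ⟨i, hi⟩
    obtain ⟨D, hD, hDg⟩ := S.exists_nhdsSet_diagonal_deckLimit_eq i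
    rw [nhdsSet_diagonal_eq_uniformity] at hD
    obtain ⟨x⟩ : Nonempty S.Limit := inferInstance
    exact ⟨D, hD, fun h hh => hi h (hDg g h x (hh x))⟩

/-! ### The projection of the inverse limit -/

theorem isGeneralizedRegularCoveringMap [IsContinuum X] (φ : S.Limit → X)
    (hφ : ∀ (i : CoverIndex X) (x : S.Limit), φ x = i.map (x.1 i)) :
    IsCompactGeneralizedRegularCoveringMap S.deckLimit φ := by
  obtain ⟨i₀⟩ : Nonempty (CoverIndex X) := inferInstance
  have hφ₀ : φ = i₀.map ∘ fun x : S.Limit => x.1 i₀ := funext (hφ i₀)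
  have hcont : Continuous φ := by
    rw [hφ₀]
    exact i₀.cover.isLocalHomeomorph_map.continuous.comp (S.continuous_proj i₀)
  have hsurj : Function.Surjective φ := by
    rw [hφ₀]
    exact i₀.cover.surjective_map.comp (S.surjective_proj i₀)
  obtain ⟨x₀⟩ : Nonempty S.Limit := inferInstance
  let uL : UniformSpace S.Limit := uniformSpaceOfCompactR1
  let uX : UniformSpace X := uniformSpaceOfCompactR1
  have hL : 𝓤 S.Limit = 𝓝ˢ (diagonal S.Limit) := nhdsSet_diagonal_eq_uniformity.symm
  have hX : 𝓤 X = 𝓝ˢ (diagonal X) := nhdsSet_diagonal_eq_uniformity.symm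
  refine @IsGeneralizedRegularCoveringMap.mk _ _ _ _ _ _ _ _ ?_ ?_ ?_ ?_
    ⟨hsurj, CompactSpace.uniformContinuous_of_continuous hcont, ?_⟩ ?_
  · refine ⟨fun {g h} e => Subtype.ext (funext fun i => ?_)⟩
    exact deck_eq_of_apply_eq (congrArg (fun x : S.Limit => x.1 i) (e x₀))
  · intro E hE
    obtain ⟨i, D, hD, hDE⟩ := S.exists_preimage_subset (hL ▸ hE)
    -- Intersecting the translates of `D` under the finite group `G_i` yields an invariant
    -- entourage.
    let F : Set (S.Limit × S.Limit) :=
      {p | ∀ g : i.Deck, (g.1 (p.1.1 i), g.1 (p.2.1 i)) ∈ D}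
    have hF : ∀ (h : S.deckLimit) (p : S.Limit × S.Limit), p ∈ F → (h • p.1, h • p.2) ∈ F :=
      fun h p hp g => hp (g * h.1 i)
    refine ⟨F, ?_, fun p hp => hDE _ _ (hp 1), fun h => Subset.antisymm ?_ ?_⟩
    · have : F = ⋂ g : i.Deck, {p : S.Limit × S.Limit | (p.1.1 i, p.2.1 i) ∈
          Prod.map g.1 g.1 ⁻¹' D} := by
        ext p
        simp only [mem_iInter]
        rfl
      rw [this, hL, iInter_mem]
      intro g
      apply S.preimage_mem_nhdsSet_diagonal
      have hc : Continuous (Prod.map g.1 g.1) := g.1.continuous.prodMap g.1.continuous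
      exact hc.tendsto_nhdsSet (t := diagonal i.Space)
        (fun p (hp : p.1 = p.2) => congrArg g.1 hp) hD
    · rintro _ ⟨p, hp, rfl⟩
      exact hF h p hp
    · intro p hp
      exact ⟨_, hF h⁻¹ p hp, Prod.ext (smul_inv_smul h p.1) (smul_inv_smul h p.2)⟩
  · intro E hE
    obtain ⟨i, hi⟩ := S.exists_kernelPair_subset (hL ▸ hE)
    obtain ⟨D, hD, hDg⟩ := S.exists_nhdsSet_diagonal_deckLimit_eq i
    refine ⟨D, hL ▸ hD, fun h hh y => hi _ _ ?_⟩
    -- The generators act trivially on `X_i`, hence so does the whole subgroup.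
    have hle : closeSubgroup S.deckLimit D ≤
        ((Pi.evalMonoidHom (fun i : CoverIndex X => i.Deck) i).comp S.deckLimit.subtype).ker := by
      refine (Subgroup.closure_le _).2 ?_
      rintro g ⟨y, hy⟩
      exact hDg 1 g y (by rwa [one_smul])
    have h1 : h.1 i = 1 := hle hh
    change y.1 i = (h.1 i).1 (y.1 i)
    rw [h1]
    rfl
  · let := uniformConvergenceUniformity S.deckLimit S.Limit
    have : @CompactSpace S.deckLimit (uniformConvergenceTopology S.deckLimit S.Limit) := by
      rw [S.uniformConvergenceTopology_eq]
      exact S.isProfiniteGroup_deckLimit.compact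
    exact complete_of_compact
  · intro E hE
    obtain ⟨i, D, hD, hDE⟩ := S.exists_preimage_subset (hL ▸ hE)
    obtain ⟨U, hU, hdU, hUD⟩ := mem_nhdsSet_iff_exists.1 hD
    have ho := i.cover.isLocalHomeomorph_map.isOpenMap
    rw [hX]
    refine mem_nhdsSet_iff_exists.2 ⟨_, ho.prodMap ho U hU, ?_, ?_⟩
    · rintro ⟨x, y⟩ (rfl : x = y)
      obtain ⟨z, rfl⟩ := i.cover.surjective_map x
      exact ⟨(z, z), hdU rfl, rfl⟩
    · rintro _ ⟨⟨a, b⟩, hab, rfl⟩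
      obtain ⟨x, rfl⟩ := S.surjective_proj i a
      obtain ⟨y, rfl⟩ := S.surjective_proj i b
      exact ⟨(x, y), hDE x y (hUD hab), Prod.ext (hφ i x) (hφ i y)⟩
  · intro y z
    constructor
    · intro e
      have hex : ∀ i : CoverIndex X, ∃ g : i.Deck, g.1 (y.1 i) = z.1 i := fun i => by
        obtain ⟨g, hg, h⟩ := (i.cover.isRegular.fiber_iff (y.1 i) (z.1 i)).1
          ((hφ i y).symm.trans (e.trans (hφ i z)))
        exact ⟨⟨g, hg⟩, h⟩
      choose g hg using hex
      -- The separately chosen `g i` are automatically compatible: `g i` and the image of `g j` both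
      -- send `y.1 i` to `z.1 i`, and the action is free.
      refine ⟨⟨g, fun i j h => deck_eq_of_apply_eq (y := y.1 i) ?_⟩, Limit.ext hg⟩
      rw [hg, ← y.2 i j h, S.compat, hg, z.2]
    · rintro ⟨g, rfl⟩
      rw [hφ i₀, hφ i₀]
      exact (i₀.cover.map_deck (g.1 i₀) (y.1 i₀)).symm

theorem exists_isGeneralizedRegularCoveringMap [IsContinuum X] :
    ∃ φ : S.Limit → X, (∀ (i : CoverIndex X) (x : S.Limit), φ x = i.map (x.1 i)) ∧
      IsCompactGeneralizedRegularCoveringMap S.deckLimit φ := by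
  obtain ⟨i₀⟩ : Nonempty (CoverIndex X) := inferInstance
  have h : ∀ (i : CoverIndex X) (x : S.Limit), i₀.map (x.1 i₀) = i.map (x.1 i) := fun i x => by
    obtain ⟨k, h0, hi⟩ := CoverIndex.exists_upper_bound i₀ i
    rw [← x.2 i₀ k h0, ← x.2 i k hi]
    exact (S.map_map _ _ _ _).trans (S.map_map _ _ _ _).symm
  exact ⟨_, h, S.isGeneralizedRegularCoveringMap _ h⟩

end BondingSystem

theorem theorem1 (X : Type u) [TopologicalSpace X] [IsContinuum X] :
    -- the covers of `X` by continua form a directed set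
    (Nonempty (CoverIndex X) ∧
      (∀ i j : CoverIndex X, i ≤ j → j ≤ i → i = j) ∧
      ∀ i j : CoverIndex X, ∃ k, i ≤ k ∧ j ≤ k) ∧
    -- there is an inverse system of bonding maps with compatible homomorphisms of deck groups
    Nonempty (BondingSystem X) ∧
    -- and every such system has the following properties
    ∀ S : BondingSystem X,
      -- the bonding maps are regular covering maps, unique modulo the deck group `G_i`
      (∀ i j (h : i ≤ j), IsRegularCoveringMap (S.map i j h) ∧
        ∀ f : j.Space → i.Space, (IsRegularCoveringMap f ∧ i.map ∘ f = j.map) ↔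
          ∃ g : i.Deck, f = g.1 ∘ S.map i j h) ∧
      -- the inverse limit is a continuum, and its projection to `X` is a generalized regular
      -- covering map whose deck group is the inverse limit of the deck groups `G_i`
      (∃ _ : IsContinuum S.Limit,
        (∃ φ : S.Limit → X, (∀ (i : CoverIndex X) (x : S.Limit), φ x = i.map (x.1 i)) ∧
          IsCompactGeneralizedRegularCoveringMap S.deckLimit φ) ∧
        -- the topology of uniform convergence on this group is the inverse limit topology
        uniformConvergenceTopology S.deckLimit S.Limit = S.deckLimitTopology) ∧
      -- the groups `G_i` are finite, and their inverse limit is profinite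
      (∀ i : CoverIndex X, Finite i.Deck) ∧
      IsProfiniteGroup S.deckLimit := by
  refine ⟨⟨inferInstance, fun i j => CoverIndex.le_antisymm', CoverIndex.exists_upper_bound⟩,
    nonempty_bondingSystem X, fun S => ⟨fun i j h => ⟨?_,
      S.isRegularCoveringMap_and_map_comp_eq_iff i j h⟩, ⟨S.isContinuum_limit,
      S.exists_isGeneralizedRegularCoveringMap, S.uniformConvergenceTopology_eq⟩,
      fun i => i.cover.finite_deck, S.isProfiniteGroup_deckLimit⟩⟩
  exact S.isRegularCoveringMap_deck_comp i j h 1
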